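/- Let $\mathbb{L}>0$, $\sigma>0$, and let $V,p\in C^2(\mathbb{R})$, where $p$ is $\mathbb{L}$-periodic, $V'$ is globally Lipschitz on $\mathbb{R}$, and there exist $\beta>0$ and $R\ge 1$ such that $-\operatorname{sign}(x)V'(x)\le-\beta|x|$ for all $|x|\ge R$. For $\varepsilon>0$ let $$\rho^\varepsilon(x)=\frac{1}{Z^\varepsilon}e^{-\frac{1}{\sigma^2}\left(V(x)+p(x/\varepsilon)\right)},\qquad \rho(x)=\frac1Z e^{-\frac{1}{\sigma^2}V(x)},$$ with $Z^\varepsilon=\int_{\mathbb{R}}e^{-\frac{1}{\sigma^2}(V(x)+p(x/\varepsilon))}\,\mathrm{d}x$ and $Z=\int_{\mathbb{R}}e^{-\frac{1}{\sigma^2}V(x)}\,\mathrm{d}x$, be the invariant densities of the multiscale diffusion $\mathrm{d}X_t^\varepsilon=-V'(X_t^\varepsilon)\,\mathrm{d}t-\frac1\varepsilon p'(X_t^\varepsilon/\varepsilon)\,\mathrm{d}t+\sqrt{2\sigma^2}\,\mathrm{d}W_t$ and of its homogenized limit. Let $\psi_n(x)=(\sqrt{\pi}\,2^n n!)^{-1/2}e^{-x^2/2}H_n(x)$,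 $n\ge 0$, be the Hermite functions, $H_n$ being the $n$-th physicist's Hermite polynomial, and let $$\rho^\varepsilon_N(x)=\sum_{n=0}^{N-1}\alpha_n^\varepsilon\,\psi_n(x),\qquad \alpha_n^\varepsilon=\int_{\mathbb{R}}\psi_n(x)\rho^\varepsilon(x)\,\mathrm{d}x.$$ With $c=\frac{\sigma^2+1}{\sigma^2}$, let $\gamma>3+\log 8$ if $\sigma^2=1$, and $\gamma>c^2+\max\left\{16e^{3/2},\frac c4\left(\log\left|\frac2c-1\right|+2\log 4\right)\right\}$ if $\sigma^2\ne1$. Let $(\varepsilon_k)_k$ be a sequence of positive numbers with $\varepsilon_k\to0$, and let $(N_k)_k$ be a sequence of natural numbers with $N_k\to\infty$ and $$2\le N_k\le\left\lfloor\frac{\pi^2}{\gamma\,\mathbb{L}^2\varepsilon_k^2}\right\rfloor\qquad\text{for all }k.$$ Then $$\lim_{k\to\infty}\left\|\rho^{\varepsilon_k}_{N_k}-\rho\right\|_{L^2(\mathbb{R})}=0.$$ -/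

import Mathlib

open Filter Topology MeasureTheory

namespace MultiscaleLangevin

noncomputable section

/-- Standing assumptions on the confining slow-scale potential `V` and the `L`-periodic fast-scale
potential `p`: both are `C²`, `V'` is globally Lipschitz, and `V` is dissipative at infinity. -/
structure PotentialAssumptions (V p : ℝ → ℝ) (L : ℝ) : Prop where
  contDiff_slow : ContDiff ℝ 2 V
  contDiff_fast : ContDiff ℝ 2 p
  periodic_fast : Function.Periodic p L
  lipschitz_deriv : ∃ K : NNReal, LipschitzWith K (deriv V)
  dissipative : ∃ β > 0, ∃ R ≥ 1, ∀ x : ℝ, R ≤ |x| → -Real.sign x * deriv V x ≤ -β * |x|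

/-- The normalization constant of the Gibbs density `exp (-U / σ²) / Z`. -/
def partitionFunction (U : ℝ → ℝ) (σ : ℝ) : ℝ :=
  ∫ x, Real.exp (-(1 / σ ^ 2) * U x)

/-- The Gibbs density `x ↦ exp (-U x / σ²) / Z`. -/
def gibbsDensity (U : ℝ → ℝ) (σ : ℝ) (x : ℝ) : ℝ :=
  1 / partitionFunction U σ * Real.exp (-(1 / σ ^ 2) * U x)

/-- The invariant density `ρ^ε` of the multiscale dynamics
`dX = -V'(X) dt - ε⁻¹ p'(X / ε) dt + √(2σ²) dW`. -/
def multiscaleDensity (V p : ℝ → ℝ) (σ ε : ℝ) : ℝ → ℝ :=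
  gibbsDensity (fun x => V x + p (x / ε)) σ

/-- The invariant density `ρ` of the homogenized dynamics. Its drift `-𝒦 V'` and its diffusion
coefficient `𝒦 σ²` carry the same factor `𝒦 > 0`, which cancels in the Gibbs exponent. -/
def homogenizedDensity (V : ℝ → ℝ) (σ : ℝ) : ℝ → ℝ :=
  gibbsDensity V σ

/-- The physicist's Hermite polynomials, `H₀ = 1` and `Hₙ₊₁ = 2 X Hₙ - Hₙ'`. -/
def physHermite : ℕ → Polynomial ℝ
  | 0 => 1
  | n + 1 => 2 * Polynomial.X * physHermite n - Polynomial.derivative (physHermite n)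

/-- The `n`-th Hermite function `ψₙ(x) = (√π 2ⁿ n!)^(-1/2) exp (-x² / 2) Hₙ(x)`. -/
def hermiteFunction (n : ℕ) (x : ℝ) : ℝ :=
  1 / √(√Real.pi * 2 ^ n * (n.factorial : ℝ)) * Real.exp (-(x ^ 2 / 2)) * (physHermite n).eval x

/-- The `n`-th Fourier coefficient of `f` with respect to the Hermite functions. -/
def hermiteCoeff (f : ℝ → ℝ) (n : ℕ) : ℝ :=
  ∫ x, hermiteFunction n x * f x

/-- The truncation of the Hermite expansion of `f` to its first `N` terms `n = 0, …, N - 1`. -/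
def hermiteProjection (f : ℝ → ℝ) (N : ℕ) (x : ℝ) : ℝ :=
  ∑ n ∈ Finset.range N, hermiteCoeff f n * hermiteFunction n x

/-- The lower bound for `γ` in terms of the diffusion coefficient `σ`, where
`c = (σ² + 1) / σ²`. -/
def gammaThreshold (σ : ℝ) : ℝ :=
  open Classical in
  if σ ^ 2 = 1 then 3 + Real.log 8
  else
    let c : ℝ := (σ ^ 2 + 1) / σ ^ 2
    c ^ 2 + max (16 * Real.exp (3 / 2)) (c / 4 * (Real.log |2 / c - 1| + 2 * Real.log 4))

end

end MultiscaleLangevin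

/-!
The fast factor `G(x / ε)`, `G = e^{-p / σ²}`, has frequency `ω = 2π / (L ε)`, and the bound on `N`
reads `ω² ≥ 4 γ N` with `γ > 3`. The first `N` Hermite functions occupy the disc of radius `√(2N)`
in phase space, so a function modulated at frequency `ω` is asymptotically invisible to the
projection `P_N` onto their span. Hence `P_N (F · G(· / ε)) → (mean of G) F` in `L²` for every
`F ∈ L²` (`tendsto_partialSum_periodicMul`), and the theorem is the case `F = e^{-V / σ²}`, because
the partition functions converge to the mean of `G` times `Z` by the Riemann-Lebesgue lemma.

All operators involved are bounded uniformly in `ε` and `N`, so it suffices to verify the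
convergence on total sets of `G` and of `F` (`tendsto_apply_of_span_dense`). For `G` these are the
characters of the circle. For `F` these are the modulated Gaussians `ψ₀ e^{isx}`, which are total
by injectivity of the Fourier transform on `L¹` (`span_modulatedGaussian_dense`). A character turns
one modulated Gaussian into another, and the squared Hermite coefficients of `ψ₀ e^{itx}` are the
Poisson weights of mean `t² / 2` (`norm_sq_integral_hermiteFunction_mul_cexp`). Consequently
`‖P_N (ψ₀ e^{itx})‖²` is the probability that a Poisson variable of mean `t² / 2` is below `N`. For
fixed `t` it tends to `1`, which also gives completeness of the Hermite functions. For
`t = s + j ω` with `j ≠ 0` the mean eventually exceeds `3 N` and the probability is exponentially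
small by Chernoff's bound (`sum_range_poisson_le_exp`).
-/

namespace MultiscaleLangevin

/-! ### Gaussian integrals of Hermite polynomials -/

theorem integrable_eval_mul_exp_neg_sq (q : Polynomial ℝ) :
    Integrable fun x : ℝ => q.eval x * Real.exp (-x ^ 2) := by
  induction q using Polynomial.induction_on' with
  | add p q hp hq =>
    simpa only [Polynomial.eval_add, add_mul] using! hp.add hq
  | monomial n a =>
    have h := (integrable_rpow_mul_exp_neg_mul_sq (b := 1) one_pos (s := n)
      (by linarith [(Nat.cast_nonneg n : (0 : ℝ) ≤ n)])).const_mul a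
    refine h.congr (ae_of_all _ fun x => ?_)
    simp only [Polynomial.eval_monomial, Real.rpow_natCast]
    ring_nf

/-- The total derivative of `q e^{-x²}` integrates to zero. -/
theorem integral_deriv_sub_two_mul_X_mul (q : Polynomial ℝ) :
    ∫ x : ℝ, (Polynomial.derivative q - 2 * Polynomial.X * q).eval x * Real.exp (-x ^ 2) = 0 := by
  refine integral_eq_zero_of_hasDerivAt_of_integrable
    (f := fun x => q.eval x * Real.exp (-x ^ 2)) (fun x => ?_)
    (integrable_eval_mul_exp_neg_sq _) (integrable_eval_mul_exp_neg_sq _)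
  convert! (q.hasDerivAt x).mul ((hasDerivAt_pow 2 x).neg.exp) using 1
  simp
  ring

theorem derivative_physHermite_succ (n : ℕ) :
    Polynomial.derivative (physHermite (n + 1)) = (2 * (n + 1) : ℝ) • physHermite n := by
  induction n with
  | zero => simp [physHermite, ← Polynomial.C_ofNat, Polynomial.smul_eq_C_mul]
  | succ n ih =>
    have h2 : physHermite (n + 2) = 2 * Polynomial.X * physHermite (n + 1)
        - Polynomial.derivative (physHermite (n + 1)) := rfl
    have h1 : physHermite (n + 1) = 2 * Polynomial.X * physHermite n
        - Polynomial.derivative (physHermite n) := rfl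
    rw [show n + 1 + 1 = n + 2 from rfl, h2, Polynomial.derivative_sub, Polynomial.derivative_mul,
      ih, Polynomial.derivative_smul]
    nth_rewrite 1 [h1]
    rw [h1]
    simp only [Polynomial.smul_eq_C_mul, Polynomial.derivative_mul, Polynomial.derivative_X,
      Polynomial.derivative_ofNat, map_mul, map_add, map_natCast, map_ofNat, map_one,
      Nat.cast_add, Nat.cast_one]
    ring

/-- Orthogonality of the Hermite polynomials for the weight `e^{-x²}`. -/
theorem integral_physHermite_mul_physHermite (m n : ℕ) :
    ∫ x : ℝ, (physHermite m * physHermite n).eval x * Real.exp (-x ^ 2) =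
      if m = n then √Real.pi * 2 ^ n * (n.factorial : ℝ) else 0 := by
  -- Integration by parts lowers the index of a Hermite factor and differentiates the other factor.
  have step (q : Polynomial ℝ) (n : ℕ) :
      ∫ x : ℝ, (q * physHermite (n + 1)).eval x * Real.exp (-x ^ 2) =
        ∫ x : ℝ, (Polynomial.derivative q * physHermite n).eval x * Real.exp (-x ^ 2) := by
    have h := integral_deriv_sub_two_mul_X_mul (q * physHermite n)
    have e : Polynomial.derivative (q * physHermite n) - 2 * Polynomial.X * (q * physHermite n) =
        Polynomial.derivative q * physHermite n - q * physHermite (n + 1) := by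
      simp only [physHermite, Polynomial.derivative_mul]
      ring
    simp only [e, Polynomial.eval_sub, sub_mul] at h
    rw [integral_sub (integrable_eval_mul_exp_neg_sq _) (integrable_eval_mul_exp_neg_sq _)] at h
    linarith
  induction n generalizing m with
  | zero =>
    cases m with
    | zero => simpa [physHermite] using integral_gaussian 1
    | succ m =>
      rw [mul_comm, step]
      simp [physHermite]
  | succ n ih =>
    rw [step]
    cases m with
    | zero => simp [physHermite]
    | succ m =>
      simp only [derivative_physHermite_succ, smul_mul_assoc, Polynomial.eval_smul, smul_eq_mul,
        mul_assoc]
      rw [integral_const_mul, integral_const_mul]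
      have := ih m
      rw [this]
      by_cases h : m = n
      · subst h
        simp [Nat.factorial_succ]
        ring
      · simp [h]

/-- The characteristic function of `Hₙ e^{-x²}`. -/
theorem integral_physHermite_mul_cexp (n : ℕ) (t : ℝ) :
    ∫ x : ℝ, ((physHermite n).eval x * Real.exp (-x ^ 2) : ℝ) * Complex.exp (t * x * Complex.I) =
      (Complex.I * t) ^ n * √Real.pi * Complex.exp (-t ^ 2 / 4) := by
  have hint (q : Polynomial ℝ) : Integrable fun x : ℝ =>
      ((q.eval x * Real.exp (-x ^ 2) : ℝ) : ℂ) * Complex.exp (t * x * Complex.I) := by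
    refine (integrable_eval_mul_exp_neg_sq q).ofReal.mul_bdd (c := 1)
      (by fun_prop) (ae_of_all _ fun x => ?_)
    rw [← Complex.ofReal_mul, Complex.norm_exp_ofReal_mul_I]
  induction n with
  | zero =>
    have h := fourierIntegral_gaussian (b := 1) (by simp) (t : ℂ)
    have hpi : (Real.pi : ℂ) ^ (1 / 2 : ℂ) = √Real.pi := by
      rw [Real.sqrt_eq_rpow, Complex.ofReal_cpow Real.pi_pos.le]
      simp
    simp only [div_one, mul_one, hpi] at h
    simp only [pow_zero, one_mul, ← h]
    refine integral_congr_ae (ae_of_all _ fun x => ?_)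
    simp [physHermite]
    ring_nf
  | succ n ih =>
    have hd := integral_eq_zero_of_hasDerivAt_of_integrable
      (f := fun x : ℝ => (((physHermite n).eval x * Real.exp (-x ^ 2) : ℝ) : ℂ) *
        Complex.exp (t * x * Complex.I))
      (f' := fun x : ℝ => Complex.I * t * ((((physHermite n).eval x * Real.exp (-x ^ 2) : ℝ) : ℂ) *
        Complex.exp (t * x * Complex.I)) - (((physHermite (n + 1)).eval x * Real.exp (-x ^ 2) : ℝ)
        : ℂ) * Complex.exp (t * x * Complex.I)) (fun x => ?_)
      (((hint _).const_mul _).sub (hint _)) (hint _)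
    · rw [integral_sub ((hint _).const_mul _) (hint _), integral_const_mul, ih] at hd
      rw [← sub_eq_zero.mp hd]
      ring
    · have h1 := (((physHermite n).hasDerivAt x).mul ((hasDerivAt_pow 2 x).neg.exp)).ofReal_comp
      have h2 : HasDerivAt (fun x : ℝ => Complex.exp (t * x * Complex.I))
          (Complex.exp (t * x * Complex.I) * (t * 1 * Complex.I)) x :=
        ((Complex.ofRealCLM.hasDerivAt.const_mul (t : ℂ)).mul_const Complex.I).cexp
      convert! h1.mul h2 using 1
      simp [physHermite]
      ring

/-! ### Hermite functions -/

theorem continuous_hermiteFunction (n : ℕ) : Continuous (hermiteFunction n) := by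
  unfold hermiteFunction
  fun_prop

theorem hermiteFunction_mul (m n : ℕ) (x : ℝ) :
    hermiteFunction m x * hermiteFunction n x =
      1 / √(√Real.pi * 2 ^ m * (m.factorial : ℝ)) * (1 / √(√Real.pi * 2 ^ n * (n.factorial : ℝ))) *
        ((physHermite m * physHermite n).eval x * Real.exp (-x ^ 2)) := by
  have : Real.exp (-x ^ 2) = Real.exp (-(x ^ 2 / 2)) * Real.exp (-(x ^ 2 / 2)) := by
    rw [← Real.exp_add]; ring_nf
  rw [this, hermiteFunction, hermiteFunction, Polynomial.eval_mul]
  ring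

theorem memLp_hermiteFunction (n : ℕ) : MemLp (hermiteFunction n) 2 := by
  rw [memLp_two_iff_integrable_sq (continuous_hermiteFunction n).aestronglyMeasurable]
  simp only [pow_two (hermiteFunction n _), hermiteFunction_mul]
  exact (integrable_eval_mul_exp_neg_sq _).const_mul _

theorem integral_hermiteFunction_mul_hermiteFunction (m n : ℕ) :
    ∫ x, hermiteFunction m x * hermiteFunction n x = if m = n then 1 else 0 := by
  simp only [hermiteFunction_mul]
  rw [integral_const_mul, integral_physHermite_mul_physHermite]
  split_ifs with h
  · subst h
    have : 0 < √Real.pi * 2 ^ m * (m.factorial : ℝ) := by positivity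
    field_simp
    rw [Real.sq_sqrt this.le]
  · simp

/-- The Hermite coefficients of the modulated Gaussian `ψ₀ e^{itx}`: their squared moduli are the
weights of the Poisson distribution with mean `t² / 2`. -/
theorem norm_sq_integral_hermiteFunction_mul_cexp (n : ℕ) (t : ℝ) :
    ‖∫ x : ℝ, (hermiteFunction n x : ℂ) * (hermiteFunction 0 x * Complex.exp (t * x * Complex.I))‖
      ^ 2 = Real.exp (-(t ^ 2 / 2)) * ((t ^ 2 / 2) ^ n / n.factorial) := by
  have h1 : ∀ x : ℝ, (hermiteFunction n x : ℂ) * (hermiteFunction 0 x *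
      Complex.exp (t * x * Complex.I)) =
      ((1 / √(√Real.pi * 2 ^ n * (n.factorial : ℝ)) * (1 / √√Real.pi) : ℝ) : ℂ) *
      (((physHermite n).eval x * Real.exp (-x ^ 2) : ℝ) * Complex.exp (t * x * Complex.I)) := by
    intro x
    have := hermiteFunction_mul n 0 x
    simp only [physHermite, mul_one, Nat.factorial_zero, Nat.cast_one, pow_zero] at this
    rw [← mul_assoc, ← Complex.ofReal_mul, this]
    push_cast
    ring
  simp only [h1]
  have h2 : Complex.exp (-t ^ 2 / 4) = (Real.exp (-t ^ 2 / 4) : ℝ) := by push_cast; rfl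
  rw [integral_const_mul, integral_physHermite_mul_cexp, h2]
  simp only [norm_mul, norm_pow, Complex.norm_I, one_mul, Complex.norm_real, Real.norm_eq_abs,
    Real.abs_exp]
  have hs : (√√Real.pi) ^ 2 = √Real.pi := Real.sq_sqrt (Real.sqrt_nonneg _)
  have hn : √(√Real.pi * 2 ^ n * (n.factorial : ℝ)) ^ 2 = √Real.pi * 2 ^ n * (n.factorial : ℝ) :=
    Real.sq_sqrt (by positivity)
  have he : Real.exp (-t ^ 2 / 4) ^ 2 = Real.exp (-(t ^ 2 / 2)) := by
    rw [← Real.exp_nat_mul]; congr 1; push_cast; ring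
  have ht : (|t| ^ n) ^ 2 = (t ^ 2) ^ n := by
    rw [← pow_mul, mul_comm, pow_mul, sq_abs]
  simp only [mul_pow, he, ht, sq_abs, div_pow, hs, hn, one_pow]
  field_simp

/-! ### Poisson tails -/

theorem tendsto_sum_range_poisson (a : ℝ) :
    Tendsto (fun N => ∑ n ∈ Finset.range N, Real.exp (-a) * (a ^ n / n.factorial)) atTop (𝓝 1) := by
  have h := ((NormedSpace.expSeries_div_hasSum_exp a).mul_left (Real.exp (-a))).tendsto_sum_nat
  rwa [← Real.exp_eq_exp_ℝ, ← Real.exp_add, neg_add_cancel, Real.exp_zero] at h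

/-- Chernoff bound: a Poisson variable of mean `a ≥ 3 N` is rarely below `N`. -/
theorem sum_range_poisson_le_exp {a : ℝ} {N : ℕ} (ha : 3 * N ≤ a) :
    ∑ n ∈ Finset.range N, Real.exp (-a) * (a ^ n / n.factorial) ≤ Real.exp (-(N / 2)) := by
  have ha0 : 0 ≤ a := le_trans (by positivity) ha
  -- Each factor `2 ^ (N - n)` is at least one, which makes the bound `2 ^ N e ^ (-a / 2)`.
  have h2 : (2 : ℝ) ^ N ≤ Real.exp N := by
    rw [← Real.exp_one_pow]
    gcongr
    linarith [Real.add_one_le_exp 1]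
  calc _ = Real.exp (-a) * ∑ n ∈ Finset.range N, a ^ n / n.factorial := by rw [Finset.mul_sum]
    _ ≤ Real.exp (-a) * ∑ n ∈ Finset.range N, 2 ^ N * ((a / 2) ^ n / n.factorial) := by
      gcongr with n hn
      have : (2 : ℝ) ^ n ≤ 2 ^ N := pow_le_pow_right₀ one_le_two (Finset.mem_range.mp hn).le
      calc a ^ n / n.factorial = 2 ^ n * ((a / 2) ^ n / n.factorial) := by
            rw [div_pow]; field_simp
        _ ≤ _ := by gcongr
    _ = Real.exp (-a) * (2 ^ N * ∑ n ∈ Finset.range N, (a / 2) ^ n / n.factorial) := by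
      rw [Finset.mul_sum (Finset.range N) _ ((2 : ℝ) ^ N)]
    _ ≤ Real.exp (-a) * (Real.exp N * Real.exp (a / 2)) := by
      gcongr
      exact Real.sum_le_exp_of_nonneg (by positivity) N
    _ ≤ _ := by
      rw [← Real.exp_add, ← Real.exp_add, Real.exp_le_exp]
      linarith

/-! ### Strong convergence of bounded operators -/

/-- Uniformly bounded operators that converge pointwise on a total set converge strongly. -/
theorem tendsto_apply_of_span_dense {E F : Type*} [NormedAddCommGroup E] [NormedSpace ℂ E]
    [NormedAddCommGroup F] [NormedSpace ℂ F] {A : ℕ → E →L[ℂ] F} {B : E →L[ℂ] F} {M : ℝ}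
    (hA : ∀ k, ‖A k‖ ≤ M) {S : Set E} (hS : (Submodule.span ℂ S).topologicalClosure = ⊤)
    (h : ∀ s ∈ S, Tendsto (fun k => A k s) atTop (𝓝 (B s))) (x : E) :
    Tendsto (fun k => A k x) atTop (𝓝 (B x)) := by
  have hspan : ∀ y ∈ Submodule.span ℂ S, Tendsto (fun k => A k y) atTop (𝓝 (B y)) := by
    intro y hy
    induction hy using Submodule.span_induction with
    | mem y hy => exact h y hy
    | zero => simp
    | add y z _ _ hy hz => simpa using hy.add hz
    | smul c y _ hy => simpa using hy.const_smul c
  have hM : 0 ≤ M := (norm_nonneg _).trans (hA 0)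
  have hC : 0 < M + ‖B‖ + 1 := by positivity
  rw [← tendsto_sub_nhds_zero_iff, NormedAddGroup.tendsto_nhds_zero]
  intro δ hδ
  obtain ⟨y, hy, hxy⟩ := Metric.dense_iff.mp
    (Submodule.dense_iff_topologicalClosure_eq_top.mpr hS) x (δ / 2 / (M + ‖B‖ + 1)) (by positivity)
  have hlim := hspan y hxy
  rw [← tendsto_sub_nhds_zero_iff, NormedAddGroup.tendsto_nhds_zero] at hlim
  filter_upwards [hlim (δ / 2) (by positivity)] with k hk
  rw [Metric.mem_ball, dist_comm, dist_eq_norm, lt_div_iff₀ hC] at hy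
  have e : A k x - B x = A k (x - y) - B (x - y) + (A k y - B y) := by
    simp only [map_sub]; abel
  calc ‖A k x - B x‖ ≤ ‖A k (x - y)‖ + ‖B (x - y)‖ + ‖A k y - B y‖ := by
        rw [e]; exact (norm_add_le _ _).trans (by gcongr; exact norm_sub_le _ _)
    _ ≤ M * ‖x - y‖ + ‖B‖ * ‖x - y‖ + ‖A k y - B y‖ := by
        gcongr
        · exact (A k).le_of_opNorm_le (hA k) _
        · exact B.le_opNorm _
    _ < δ := by nlinarith [norm_nonneg (x - y)]

/-! ### Partial sums of an orthonormal expansion -/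

section PartialSum

variable {H : Type*} [NormedAddCommGroup H] [InnerProductSpace ℂ H]

/-- The truncation `x ↦ ∑_{n < N} ⟪eₙ, x⟫ eₙ` of the expansion of `x` along `e`. -/
noncomputable def partialSum (e : ℕ → H) (N : ℕ) : H →L[ℂ] H :=
  ∑ n ∈ Finset.range N, (innerSL ℂ (e n)).smulRight (e n)

theorem partialSum_apply (e : ℕ → H) (N : ℕ) (x : H) :
    partialSum e N x = ∑ n ∈ Finset.range N, inner ℂ (e n) x • e n := by
  simp [partialSum]

theorem norm_sq_partialSum {e : ℕ → H} (he : Orthonormal ℂ e) (N : ℕ) (x : H) :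
    ‖partialSum e N x‖ ^ 2 = ∑ n ∈ Finset.range N, ‖inner ℂ (e n) x‖ ^ 2 := by
  have h := he.inner_sum (fun n => inner ℂ (e n) x) (fun n => inner ℂ (e n) x) (Finset.range N)
  rw [← partialSum_apply, inner_self_eq_norm_sq_to_K] at h
  simp only [RCLike.conj_mul] at h
  exact_mod_cast h

theorem norm_partialSum_apply_le {e : ℕ → H} (he : Orthonormal ℂ e) (N : ℕ) (x : H) :
    ‖partialSum e N x‖ ≤ ‖x‖ := by
  rw [← sq_le_sq₀ (norm_nonneg _) (norm_nonneg _), norm_sq_partialSum he]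
  exact he.sum_inner_products_le x

theorem norm_sq_sub_partialSum {e : ℕ → H} (he : Orthonormal ℂ e) (N : ℕ) (x : H) :
    ‖x - partialSum e N x‖ ^ 2 = ‖x‖ ^ 2 - ∑ n ∈ Finset.range N, ‖inner ℂ (e n) x‖ ^ 2 := by
  have h : inner ℂ x (partialSum e N x) =
      ((∑ n ∈ Finset.range N, ‖inner ℂ (e n) x‖ ^ 2 : ℝ) : ℂ) := by
    rw [partialSum_apply, inner_sum]
    push_cast
    refine Finset.sum_congr rfl fun n _ => ?_
    rw [inner_smul_right, ← inner_conj_symm x (e n), RCLike.mul_conj]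
    rfl
  rw [@norm_sub_sq ℂ, norm_sq_partialSum he, h]
  simp only [RCLike.re_to_complex, Complex.ofReal_re]
  ring

end PartialSum

/-! ### Modulated Gaussians -/

/-- The `n`-th Hermite function as an element of `L²(ℝ; ℂ)`. -/
noncomputable def hermiteLp (n : ℕ) : Lp ℂ 2 (volume : Measure ℝ) :=
  (memLp_hermiteFunction n).ofReal.toLp

theorem coeFn_hermiteLp (n : ℕ) :
    hermiteLp n =ᵐ[volume] fun x => (hermiteFunction n x : ℂ) :=
  MemLp.coeFn_toLp _

theorem inner_hermiteLp (n : ℕ) (f : Lp ℂ 2 (volume : Measure ℝ)) :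
    inner ℂ (hermiteLp n) f = ∫ x, (hermiteFunction n x : ℂ) * f x := by
  rw [L2.inner_def]
  refine integral_congr_ae ?_
  filter_upwards [coeFn_hermiteLp n] with x hx
  simp [hx, mul_comm]

theorem orthonormal_hermiteLp : Orthonormal ℂ hermiteLp := by
  rw [orthonormal_iff_ite]
  intro m n
  rw [inner_hermiteLp]
  have : ∫ x, (hermiteFunction m x : ℂ) * hermiteLp n x =
      ∫ x, ((hermiteFunction m x * hermiteFunction n x : ℝ) : ℂ) := by
    refine integral_congr_ae ?_
    filter_upwards [coeFn_hermiteLp n] with x hx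
    simp [hx]
  rw [this, integral_complex_ofReal, integral_hermiteFunction_mul_hermiteFunction]
  split_ifs <;> simp

theorem memLp_modulatedGaussian (t : ℝ) :
    MemLp (fun x : ℝ => (hermiteFunction 0 x : ℂ) * Complex.exp (t * x * Complex.I)) 2 := by
  refine MemLp.of_le (memLp_hermiteFunction 0) ?_ (ae_of_all _ fun x => ?_)
  · have := continuous_hermiteFunction 0
    fun_prop
  · rw [norm_mul, ← Complex.ofReal_mul, Complex.norm_exp_ofReal_mul_I]
    simp

/-- The modulated Gaussian `x ↦ ψ₀(x) e^{itx}` as an element of `L²(ℝ; ℂ)`. -/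
noncomputable def modulatedGaussian (t : ℝ) : Lp ℂ 2 (volume : Measure ℝ) :=
  (memLp_modulatedGaussian t).toLp

theorem norm_sq_inner_hermiteLp_modulatedGaussian (n : ℕ) (t : ℝ) :
    ‖inner ℂ (hermiteLp n) (modulatedGaussian t)‖ ^ 2 =
      Real.exp (-(t ^ 2 / 2)) * ((t ^ 2 / 2) ^ n / n.factorial) := by
  rw [inner_hermiteLp, ← norm_sq_integral_hermiteFunction_mul_cexp]
  congr 2
  refine integral_congr_ae ?_
  filter_upwards [(memLp_modulatedGaussian t).coeFn_toLp] with x hx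
  rw [modulatedGaussian, hx]

theorem norm_modulatedGaussian (t : ℝ) : ‖modulatedGaussian t‖ = 1 := by
  rw [← orthonormal_hermiteLp.1 0, modulatedGaussian, hermiteLp, Lp.norm_toLp, Lp.norm_toLp]
  congr 1
  refine eLpNorm_congr_norm_ae (ae_of_all _ fun x => ?_)
  rw [norm_mul, ← Complex.ofReal_mul, Complex.norm_exp_ofReal_mul_I]
  simp

/-- The Fourier transform is injective on `L¹(ℝ)`. -/
theorem ae_eq_zero_of_fourier_eq_zero {f : ℝ → ℂ} (hf : Integrable f)
    (h : ∀ t : ℝ, ∫ x : ℝ, Complex.exp (t * x * Complex.I) * f x = 0) : f =ᵐ[volume] 0 := by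
  have hF : ∀ w : ℝ, VectorFourier.fourierIntegral Real.fourierChar volume (innerₗ ℝ) f w = 0 := by
    intro w
    rw [VectorFourier.fourierIntegral, ← h (-2 * Real.pi * w)]
    refine integral_congr_ae (ae_of_all _ fun x => ?_)
    simp [Circle.smul_def, Real.fourierChar_apply]
    left
    ring_nf
  refine ae_eq_zero_of_integral_contDiff_smul_eq_zero hf.locallyIntegrable fun g hg hgc => ?_
  -- A test function is the Fourier transform of a Schwartz function `φ`.
  let g' : SchwartzMap ℝ ℂ := HasCompactSupport.toSchwartzMap (f := fun x => (g x : ℂ))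
    (hgc.comp_left (g := ((↑) : ℝ → ℂ)) Complex.ofReal_zero)
    (Complex.ofRealCLM.contDiff.comp hg)
  let φ : SchwartzMap ℝ ℂ := FourierTransformInv.fourierInv g'
  have hφ : FourierTransform.fourier φ = g' := FourierTransform.fourier_fourierInv_eq g'
  have key := VectorFourier.integral_fourierIntegral_smul_eq_flip (L := innerₗ ℝ)
    Real.continuous_fourierChar continuous_inner hf
    (φ.integrable (μ := volume))
  simp only [hF, zero_smul, integral_zero, flip_innerₗ] at key
  rw [key]
  refine integral_congr_ae (ae_of_all _ fun x => ?_)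
  have : VectorFourier.fourierIntegral Real.fourierChar volume (innerₗ ℝ) (φ : ℝ → ℂ) x
      = (g x : ℂ) := by
    have := congrArg (fun ψ : SchwartzMap ℝ ℂ => ψ x) hφ
    simp only [SchwartzMap.fourier_coe] at this
    exact this
  simp only [this]
  simp [mul_comm]

theorem hermiteFunction_zero_pos (x : ℝ) : 0 < hermiteFunction 0 x := by
  simp only [hermiteFunction, physHermite, Polynomial.eval_one]
  have := Real.pi_pos
  positivity

/-- Modulated Gaussians are total in `L²(ℝ; ℂ)`: if `f` is orthogonal to all of them, then the
Fourier transform of `ψ₀ f ∈ L¹` vanishes. -/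
theorem span_modulatedGaussian_dense :
    (Submodule.span ℂ (Set.range modulatedGaussian)).topologicalClosure = ⊤ := by
  rw [Submodule.topologicalClosure_eq_top_iff, Submodule.eq_bot_iff]
  intro f hf
  have hint : Integrable fun x => (hermiteFunction 0 x : ℂ) * f x :=
    (memLp_hermiteFunction 0).ofReal.integrable_mul (Lp.memLp f)
  have h0 : (fun x => (hermiteFunction 0 x : ℂ) * f x) =ᵐ[volume] 0 := by
    refine ae_eq_zero_of_fourier_eq_zero hint fun t => ?_
    have := (Submodule.mem_orthogonal _ _).mp hf _
      (Submodule.subset_span (Set.mem_range_self (-t)))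
    rw [L2.inner_def] at this
    rw [← this]
    refine integral_congr_ae ?_
    filter_upwards [(memLp_modulatedGaussian (-t)).coeFn_toLp] with x hx
    rw [modulatedGaussian, hx]
    simp [← Complex.exp_conj]
    ring
  rw [Lp.eq_zero_iff_ae_eq_zero]
  filter_upwards [h0] with x hx
  simpa [(hermiteFunction_zero_pos x).ne'] using hx

/-! ### Rapidly oscillating multipliers -/

section Periodic

variable {L : ℝ}

theorem continuous_comp_div (G : C(AddCircle L, ℂ)) (ε : ℝ) :
    Continuous fun x : ℝ => G ((x / ε : ℝ) : AddCircle L) :=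
  G.continuous.comp ((AddCircle.continuous_mk' L).comp (continuous_id.div_const ε))

theorem fourier_div (j : ℤ) (ε x : ℝ) : fourier j ((x / ε : ℝ) : AddCircle L) =
    Complex.exp ((2 * Real.pi * j / (L * ε) : ℝ) * x * Complex.I) := by
  rw [fourier_coe_apply]
  push_cast
  congr 1
  ring

variable [Fact (0 < L)]

theorem memLp_periodic_mul (G : C(AddCircle L, ℂ)) (ε : ℝ) {f : ℝ → ℂ} (hf : MemLp f 2) :
    MemLp (fun x : ℝ => G ((x / ε : ℝ) : AddCircle L) * f x) 2 :=
  hf.mul (memLp_top_of_bound (continuous_comp_div G ε).aestronglyMeasurable ‖G‖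
    (ae_of_all _ fun _ => G.norm_coe_le_norm _))

theorem integrable_periodic_mul (G : C(AddCircle L, ℂ)) (ε : ℝ) {f : ℝ → ℂ} (hf : Integrable f) :
    Integrable fun x : ℝ => G ((x / ε : ℝ) : AddCircle L) * f x :=
  hf.bdd_mul (c := ‖G‖) (continuous_comp_div G ε).aestronglyMeasurable
    (ae_of_all _ fun _ => G.norm_coe_le_norm _)

/-- Multiplication of `f ∈ L²(ℝ; ℂ)` by the `L ε`-periodic function `x ↦ G(x / ε)`, as a bounded
bilinear map in `G` and `f`. -/
noncomputable def periodicMul (L : ℝ) [Fact (0 < L)] (ε : ℝ) :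
    C(AddCircle L, ℂ) →L[ℂ] Lp ℂ 2 (volume : Measure ℝ) →L[ℂ] Lp ℂ 2 (volume : Measure ℝ) :=
  LinearMap.mkContinuous₂
    (LinearMap.mk₂ ℂ (fun G f => (memLp_periodic_mul G ε (Lp.memLp f)).toLp)
      (fun G₁ G₂ f => by
        rw [← MemLp.toLp_add]
        exact MemLp.toLp_congr _ _ (ae_of_all _ fun x => by simp [add_mul]))
      (fun c G f => by
        rw [← MemLp.toLp_const_smul]
        exact MemLp.toLp_congr _ _ (ae_of_all _ fun x => by simp [mul_assoc]))
      (fun G f₁ f₂ => by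
        rw [← MemLp.toLp_add]
        refine MemLp.toLp_congr _ _ ?_
        filter_upwards [Lp.coeFn_add f₁ f₂] with x hx
        rw [hx, Pi.add_apply, Pi.add_apply, mul_add])
      (fun c G f => by
        rw [← MemLp.toLp_const_smul]
        refine MemLp.toLp_congr _ _ ?_
        filter_upwards [Lp.coeFn_smul c f] with x hx
        simp [hx, mul_left_comm]))
    1 fun G f => by
      rw [one_mul]
      refine Lp.norm_le_mul_norm_of_ae_le_mul ?_
      filter_upwards [(memLp_periodic_mul G ε (Lp.memLp f)).coeFn_toLp] with x hx
      rw [LinearMap.mk₂_apply, hx, norm_mul]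
      gcongr
      exact G.norm_coe_le_norm _

theorem coeFn_periodicMul (ε : ℝ) (G : C(AddCircle L, ℂ)) (f : Lp ℂ 2 (volume : Measure ℝ)) :
    periodicMul L ε G f =ᵐ[volume] fun x => G ((x / ε : ℝ) : AddCircle L) * f x :=
  (memLp_periodic_mul G ε (Lp.memLp f)).coeFn_toLp

theorem norm_periodicMul_le (ε : ℝ) : ‖periodicMul L ε‖ ≤ 1 :=
  LinearMap.mkContinuous₂_norm_le _ zero_le_one _

/-- The average of a continuous function over the circle. -/
noncomputable def circleMean (L : ℝ) [Fact (0 < L)] : C(AddCircle L, ℂ) →L[ℂ] ℂ :=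
  LinearMap.mkContinuous
    { toFun := fun G => ∫ y, G y ∂AddCircle.haarAddCircle
      map_add' := fun G₁ G₂ => integral_add
        (G₁.continuous.integrable_of_hasCompactSupport (HasCompactSupport.of_compactSpace _))
        (G₂.continuous.integrable_of_hasCompactSupport (HasCompactSupport.of_compactSpace _))
      map_smul' := fun c G => integral_const_mul c _ }
    1 fun G => by
      simpa using norm_integral_le_of_norm_le_const (μ := AddCircle.haarAddCircle)
        (ae_of_all _ fun y => G.norm_coe_le_norm y)

theorem circleMean_apply (G : C(AddCircle L, ℂ)) :
    circleMean L G = ∫ y, G y ∂AddCircle.haarAddCircle := rfl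

theorem circleMean_fourier (j : ℤ) : circleMean L (fourier j) = if j = 0 then 1 else 0 := by
  rw [circleMean_apply]
  split_ifs with h
  · simp [h]
  · exact integral_eq_zero_of_add_right_eq_neg (fourier_add_half_inv_index h Fact.out)

theorem periodicMul_fourier_modulatedGaussian (ε : ℝ) (j : ℤ) (s : ℝ) :
    periodicMul L ε (fourier j) (modulatedGaussian s) =
      modulatedGaussian (s + 2 * Real.pi * j / (L * ε)) := by
  refine Lp.ext ?_
  filter_upwards [coeFn_periodicMul ε (fourier (T := L) j) (modulatedGaussian s),
    (memLp_modulatedGaussian s).coeFn_toLp,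
    (memLp_modulatedGaussian (s + 2 * Real.pi * j / (L * ε))).coeFn_toLp] with x h1 h2 h3
  rw [h1, modulatedGaussian, h2, modulatedGaussian, h3, fourier_div, mul_left_comm,
    ← Complex.exp_add]
  congr 2
  push_cast
  ring

theorem tendsto_two_pi_mul_div {ε : ℕ → ℝ} (hε_pos : ∀ k, 0 < ε k) (hε : Tendsto ε atTop (𝓝 0)) :
    Tendsto (fun k => 2 * Real.pi / (L * ε k)) atTop atTop := by
  have hL : 0 < L := Fact.out
  have h : Tendsto ε atTop (𝓝[>] 0) :=
    tendsto_nhdsWithin_iff.mpr ⟨hε, Eventually.of_forall hε_pos⟩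
  have := h.inv_tendsto_nhdsGT_zero.const_mul_atTop (r := 2 * Real.pi / L)
    (by have := Real.pi_pos; positivity)
  refine this.congr fun k => ?_
  simp only [Pi.inv_apply]
  have := (hε_pos k).ne'
  field_simp

/-- Weak convergence of `G(· / ε)` to the mean of `G`, tested against integrable functions. -/
theorem tendsto_integral_periodic_mul {ε : ℕ → ℝ} (hε_pos : ∀ k, 0 < ε k)
    (hε : Tendsto ε atTop (𝓝 0)) {f : ℝ → ℂ} (hf : Integrable f) (G : C(AddCircle L, ℂ)) :
    Tendsto (fun k => ∫ x : ℝ, G ((x / ε k : ℝ) : AddCircle L) * f x) atTop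
      (𝓝 (circleMean L G * ∫ x, f x)) := by
  let A (k : ℕ) : C(AddCircle L, ℂ) →L[ℂ] ℂ := LinearMap.mkContinuous
    { toFun := fun G => ∫ x : ℝ, G ((x / ε k : ℝ) : AddCircle L) * f x
      map_add' := fun G₁ G₂ => by
        rw [← integral_add (integrable_periodic_mul _ _ hf) (integrable_periodic_mul _ _ hf)]
        simp [add_mul]
      map_smul' := fun c G => by
        rw [RingHom.id_apply, smul_eq_mul, ← integral_const_mul]
        simp [mul_assoc] }
    (∫ x, ‖f x‖) fun G => by
      rw [mul_comm, ← integral_const_mul]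
      refine norm_integral_le_of_norm_le (hf.norm.const_mul _) (ae_of_all _ fun x => ?_)
      rw [norm_mul]
      gcongr
      exact G.norm_coe_le_norm _
  have hA (k : ℕ) : ‖A k‖ ≤ ∫ x, ‖f x‖ :=
    LinearMap.mkContinuous_norm_le _ (integral_nonneg fun _ => norm_nonneg _) _
  refine tendsto_apply_of_span_dense (A := A)
    (B := (circleMean L).smulRight (∫ x, f x)) hA span_fourier_closure_eq_top ?_ G
  rintro _ ⟨j, rfl⟩
  simp only [ContinuousLinearMap.smulRight_apply, circleMean_fourier]
  change Tendsto (fun k => ∫ x : ℝ, fourier j ((x / ε k : ℝ) : AddCircle L) * f x) atTop _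
  split_ifs with hj
  · simp [hj]
  · have hw : Tendsto (fun k => (-(j : ℝ) / L) * (ε k)⁻¹) atTop (cocompact ℝ) := by
      have hL : L ≠ 0 := (Fact.out : 0 < L).ne'
      have hjL : -(j : ℝ) / L ≠ 0 := div_ne_zero (neg_ne_zero.mpr (Int.cast_ne_zero.mpr hj)) hL
      have h : Tendsto ε atTop (𝓝[>] 0) :=
        tendsto_nhdsWithin_iff.mpr ⟨hε, Eventually.of_forall hε_pos⟩
      exact (tendsto_cocompact_of_tendsto_dist_comp_atTop (0 : ℝ) (by
        simp only [dist_zero_right, norm_mul]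
        exact (tendsto_norm_atTop_atTop.comp h.inv_tendsto_nhdsGT_zero).const_mul_atTop
          (norm_pos_iff.mpr hjL)))
    have := (Real.tendsto_integral_exp_smul_cocompact f).comp hw
    rw [zero_smul]
    refine this.congr fun k => integral_congr_ae (ae_of_all _ fun x => ?_)
    simp only [fourier_div, Circle.smul_def, Real.fourierChar_apply, smul_eq_mul]
    congr 2
    push_cast
    ring

/-- If `t² / 2 ≥ 3 N`, the modulated Gaussian `ψ₀ e^{itx}` is asymptotically orthogonal to the first
`N` Hermite functions: its projection has squared norm at most `e^{-N / 2}`. -/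
theorem tendsto_partialSum_modulatedGaussian_zero {t : ℕ → ℝ} {N : ℕ → ℕ}
    (hN : Tendsto N atTop atTop) (ht : ∀ᶠ k in atTop, 3 * (N k : ℝ) ≤ t k ^ 2 / 2) :
    Tendsto (fun k => partialSum hermiteLp (N k) (modulatedGaussian (t k))) atTop (𝓝 0) := by
  rw [tendsto_zero_iff_norm_tendsto_zero]
  have hbound : Tendsto (fun k => √(Real.exp (-((N k : ℝ) / 2)))) atTop (𝓝 0) := by
    have h1 : Tendsto (fun k => (N k : ℝ) / 2) atTop atTop :=
      (tendsto_natCast_atTop_atTop.comp hN).atTop_div_const two_pos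
    have h2 := (Real.tendsto_exp_neg_atTop_nhds_zero.comp h1).sqrt
    rwa [Real.sqrt_zero] at h2
  refine squeeze_zero' (Eventually.of_forall fun _ => norm_nonneg _) ?_ hbound
  filter_upwards [ht] with k hk
  refine Real.le_sqrt_of_sq_le ?_
  rw [norm_sq_partialSum orthonormal_hermiteLp]
  simp only [norm_sq_inner_hermiteLp_modulatedGaussian]
  exact sum_range_poisson_le_exp hk

/-- The Hermite expansion of a modulated Gaussian converges, by Parseval's identity: the Poisson
weights add up to one. -/
theorem tendsto_partialSum_modulatedGaussian {N : ℕ → ℕ} (hN : Tendsto N atTop atTop) (s : ℝ) :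
    Tendsto (fun k => partialSum hermiteLp (N k) (modulatedGaussian s)) atTop
      (𝓝 (modulatedGaussian s)) := by
  rw [tendsto_iff_norm_sub_tendsto_zero]
  have h := ((tendsto_sum_range_poisson (s ^ 2 / 2)).comp hN).const_sub 1
  have h' := h.sqrt
  rw [sub_self, Real.sqrt_zero] at h'
  refine h'.congr fun k => ?_
  rw [norm_sub_rev, ← Real.sqrt_sq (norm_nonneg _), norm_sq_sub_partialSum orthonormal_hermiteLp,
    norm_modulatedGaussian]
  simp only [norm_sq_inner_hermiteLp_modulatedGaussian, one_pow, Function.comp]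

/-- A shift by a nonzero multiple of `2π / (L ε)` brings any fixed frequency into the range
`t² / 2 ≥ 3 N`. -/
theorem eventually_three_mul_le_sq {γ : ℝ} (hγ : 3 < γ) {ε : ℕ → ℝ} (hε_pos : ∀ k, 0 < ε k)
    (hε : Tendsto ε atTop (𝓝 0)) {N : ℕ → ℕ}
    (hN_le : ∀ k, (N k : ℝ) ≤ Real.pi ^ 2 / (γ * L ^ 2 * ε k ^ 2)) (s : ℝ) {j : ℤ} (hj : j ≠ 0) :
    ∀ᶠ k in atTop, 3 * (N k : ℝ) ≤ (s + 2 * Real.pi * j / (L * ε k)) ^ 2 / 2 := by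
  have hL : 0 < L := Fact.out
  filter_upwards [(tendsto_two_pi_mul_div (L := L) hε_pos hε).eventually_ge_atTop (4 * |s|)]
    with k hk
  set ω := 2 * Real.pi / (L * ε k) with hω
  have hεk := hε_pos k
  have hω_pos : 0 < ω := by have := Real.pi_pos; positivity
  have hNω : 12 * (N k : ℝ) ≤ ω ^ 2 := by
    have h1 := hN_le k
    have h2 : Real.pi ^ 2 / (γ * L ^ 2 * ε k ^ 2) = ω ^ 2 / (4 * γ) := by
      rw [hω]; field_simp; ring
    rw [h2, le_div_iff₀ (by positivity)] at h1
    nlinarith [(Nat.cast_nonneg (N k) : (0 : ℝ) ≤ N k)]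
  have hj1 : (1 : ℝ) ≤ |(j : ℝ)| := by exact_mod_cast Int.one_le_abs hj
  -- The shift `s` is at most a quarter of the frequency `ω`, and `(3/4)² * 12 / 2 ≥ 3`.
  have h3 : 3 / 4 * ω ≤ |s + 2 * Real.pi * j / (L * ε k)| := by
    have e : 2 * Real.pi * j / (L * ε k) = j * ω := by rw [hω]; ring
    have h4 : |(j : ℝ) * ω| ≤ |s + j * ω| + |s| := by
      calc |(j : ℝ) * ω| = |(s + j * ω) - s| := by congr 1; ring
        _ ≤ _ := abs_sub _ _
    rw [abs_mul, abs_of_pos hω_pos] at h4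
    rw [e]
    nlinarith
  rw [← sq_abs]
  nlinarith

/-- Truncated Hermite expansions average out a multiplier `G(x / ε)` as long as the frequency
`2π / (L ε)` stays outside the phase-space region covered by the first `N` Hermite functions. -/
theorem tendsto_partialSum_periodicMul {γ : ℝ} (hγ : 3 < γ) {ε : ℕ → ℝ} (hε_pos : ∀ k, 0 < ε k)
    (hε : Tendsto ε atTop (𝓝 0)) {N : ℕ → ℕ} (hN : Tendsto N atTop atTop)
    (hN_le : ∀ k, (N k : ℝ) ≤ Real.pi ^ 2 / (γ * L ^ 2 * ε k ^ 2)) (G : C(AddCircle L, ℂ))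
    (f : Lp ℂ 2 (volume : Measure ℝ)) :
    Tendsto (fun k => partialSum hermiteLp (N k) (periodicMul L (ε k) G f)) atTop
      (𝓝 (circleMean L G • f)) := by
  have hP (k : ℕ) : ‖partialSum hermiteLp (N k)‖ ≤ 1 :=
    ContinuousLinearMap.opNorm_le_bound _ zero_le_one fun x => by
      simpa using norm_partialSum_apply_le orthonormal_hermiteLp (N k) x
  have hM (k : ℕ) (G : C(AddCircle L, ℂ)) : ‖periodicMul L (ε k) G‖ ≤ ‖G‖ := by
    simpa using (periodicMul L (ε k)).le_of_opNorm_le (norm_periodicMul_le (ε k)) G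
  refine tendsto_apply_of_span_dense (M := ‖f‖)
    (A := fun k => (partialSum hermiteLp (N k)).comp ((periodicMul L (ε k)).flip f))
    (B := (circleMean L).smulRight f) (fun k => ?_) span_fourier_closure_eq_top ?_ G
  · refine ContinuousLinearMap.opNorm_le_bound _ (norm_nonneg _) fun G => ?_
    calc _ ≤ ‖periodicMul L (ε k) G f‖ := norm_partialSum_apply_le orthonormal_hermiteLp _ _
      _ ≤ ‖G‖ * ‖f‖ := ContinuousLinearMap.le_of_opNorm_le _ (hM k G) f
      _ = _ := mul_comm _ _
  rintro _ ⟨j, rfl⟩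
  refine tendsto_apply_of_span_dense (M := ‖(fourier j : C(AddCircle L, ℂ))‖)
    (A := fun k => (partialSum hermiteLp (N k)).comp (periodicMul L (ε k) (fourier j)))
    (B := circleMean L (fourier j) • ContinuousLinearMap.id ℂ _) (fun k => ?_)
    span_modulatedGaussian_dense ?_ f
  · refine (ContinuousLinearMap.opNorm_comp_le _ _).trans ?_
    nlinarith [hP k, hM k (fourier j), norm_nonneg (periodicMul L (ε k) (fourier j))]
  rintro _ ⟨s, rfl⟩
  simp only [ContinuousLinearMap.comp_apply, _root_.smul_apply,
    ContinuousLinearMap.id_apply, periodicMul_fourier_modulatedGaussian, circleMean_fourier]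
  split_ifs with hj
  · simpa [hj] using tendsto_partialSum_modulatedGaussian hN s
  · rw [zero_smul]
    exact tendsto_partialSum_modulatedGaussian_zero hN
      (eventually_three_mul_le_sq hγ hε_pos hε hN_le s hj)

end Periodic

/-! ### Gibbs weights -/

/-- Dissipativity makes `V - β x² / 2` monotone outside `[-R, R]`, so its minimum over `[-R, R]` is
global. -/
theorem PotentialAssumptions.exists_mul_sq_add_le {V p : ℝ → ℝ} {L : ℝ}
    (h : PotentialAssumptions V p L) : ∃ b > 0, ∃ m : ℝ, ∀ x, b * x ^ 2 + m ≤ V x := by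
  obtain ⟨β, hβ, R, hR, hd⟩ := h.dissipative
  have hV : Differentiable ℝ V := h.contDiff_slow.differentiable (by norm_num)
  have hf (x : ℝ) : HasDerivAt (fun x => V x - β / 2 * x ^ 2) (deriv V x - β * x) x := by
    convert! (hV x).hasDerivAt.sub ((hasDerivAt_pow 2 x).const_mul (β / 2)) using 1
    simp
    ring
  have hc : Continuous fun x => V x - β / 2 * x ^ 2 :=
    continuous_iff_continuousAt.mpr fun x => (hf x).continuousAt
  have hright : MonotoneOn (fun x => V x - β / 2 * x ^ 2) (Set.Ici R) := by
    refine monotoneOn_of_deriv_nonneg (convex_Ici R) hc.continuousOn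
      (fun x _ => (hf x).differentiableAt.differentiableWithinAt) fun x hx => ?_
    rw [interior_Ici, Set.mem_Ioi] at hx
    have hx0 : 0 < x := by linarith
    have := hd x (by rw [abs_of_pos hx0]; exact hx.le)
    rw [Real.sign_of_pos hx0, abs_of_pos hx0] at this
    rw [(hf x).deriv]
    linarith
  have hleft : AntitoneOn (fun x => V x - β / 2 * x ^ 2) (Set.Iic (-R)) := by
    refine antitoneOn_of_deriv_nonpos (convex_Iic (-R)) hc.continuousOn
      (fun x _ => (hf x).differentiableAt.differentiableWithinAt) fun x hx => ?_
    rw [interior_Iic, Set.mem_Iio] at hx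
    have hx0 : x < 0 := by linarith
    have := hd x (by rw [abs_of_neg hx0]; linarith)
    rw [Real.sign_of_neg hx0, abs_of_neg hx0] at this
    rw [(hf x).deriv]
    linarith
  obtain ⟨y, -, hy⟩ := (isCompact_Icc (a := -R) (b := R)).exists_isMinOn
    (Set.nonempty_Icc.mpr (by linarith)) hc.continuousOn
  rw [isMinOn_iff] at hy
  refine ⟨β / 2, by positivity, V y - β / 2 * y ^ 2, fun x => ?_⟩
  rcases le_total x (-R) with hx | hx
  · have h1 := hleft hx (Set.mem_Iic.mpr le_rfl) hx
    have h2 := hy (-R) ⟨le_rfl, by linarith⟩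
    simp only at h1 h2
    linarith
  rcases le_total R x with hx' | hx'
  · have h1 := hright (Set.mem_Ici.mpr le_rfl) hx' hx'
    have h2 := hy R ⟨by linarith, le_rfl⟩
    simp only at h1 h2
    linarith
  · have h2 := hy x ⟨hx, hx'⟩
    linarith

theorem PotentialAssumptions.integrable_exp {V p : ℝ → ℝ} {L : ℝ}
    (h : PotentialAssumptions V p L) {a : ℝ} (ha : 0 < a) :
    Integrable fun x => Real.exp (-a * V x) := by
  obtain ⟨b, hb, m, hm⟩ := h.exists_mul_sq_add_le
  have hV := h.contDiff_slow.continuous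
  refine ((integrable_exp_neg_mul_sq (mul_pos ha hb)).const_mul (Real.exp (-a * m))).mono'
    (by fun_prop) (ae_of_all _ fun x => ?_)
  rw [Real.norm_eq_abs, Real.abs_exp, ← Real.exp_add, Real.exp_le_exp]
  nlinarith [hm x]

theorem PotentialAssumptions.memLp_exp {V p : ℝ → ℝ} {L : ℝ}
    (h : PotentialAssumptions V p L) {a : ℝ} (ha : 0 < a) :
    MemLp (fun x => Real.exp (-a * V x)) 2 := by
  have hV := h.contDiff_slow.continuous
  rw [memLp_two_iff_integrable_sq (by fun_prop)]
  refine (h.integrable_exp (mul_pos two_pos ha)).congr (ae_of_all _ fun x => ?_)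
  simp only [← Real.exp_nat_mul]
  congr 1
  push_cast
  ring

theorem PotentialAssumptions.partitionFunction_pos {V p : ℝ → ℝ} {L σ : ℝ}
    (h : PotentialAssumptions V p L) (hσ : 0 < σ) : 0 < partitionFunction V σ :=
  integral_exp_pos (h.integrable_exp (by positivity))

/-- The fast-scale Gibbs weight `e^{-p / σ²}` as a function on the circle of length `L`. -/
noncomputable def PotentialAssumptions.fastWeight {V p : ℝ → ℝ} {L : ℝ}
    (h : PotentialAssumptions V p L) (σ : ℝ) : C(AddCircle L, ℂ) where
  toFun y := ((Real.exp (-(1 / σ ^ 2) * h.periodic_fast.lift y) : ℝ) : ℂ)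
  continuous_toFun := by
    have : Continuous h.periodic_fast.lift := h.contDiff_fast.continuous.quotient_lift _
    fun_prop

theorem PotentialAssumptions.fastWeight_coe {V p : ℝ → ℝ} {L : ℝ}
    (h : PotentialAssumptions V p L) (σ y : ℝ) :
    h.fastWeight σ (y : AddCircle L) = (Real.exp (-(1 / σ ^ 2) * p y) : ℝ) := rfl

theorem PotentialAssumptions.circleMean_fastWeight_ne_zero {V p : ℝ → ℝ} {L : ℝ} [Fact (0 < L)]
    (h : PotentialAssumptions V p L) (σ : ℝ) : circleMean L (h.fastWeight σ) ≠ 0 := by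
  have hc : Continuous h.periodic_fast.lift := h.contDiff_fast.continuous.quotient_lift _
  have e : circleMean L (h.fastWeight σ) = ((∫ y, Real.exp (-(1 / σ ^ 2) * h.periodic_fast.lift y)
      ∂(AddCircle.haarAddCircle (T := L)) : ℝ) : ℂ) := by
    rw [← integral_complex_ofReal]
    rfl
  rw [e, Complex.ofReal_ne_zero]
  refine (integral_exp_pos (Continuous.integrable_of_hasCompactSupport ?_
    (HasCompactSupport.of_compactSpace _))).ne'
  fun_prop

theorem exp_add_eq_mul (V p : ℝ → ℝ) (σ ε x : ℝ) :
    Real.exp (-(1 / σ ^ 2) * (V x + p (x / ε))) =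
      Real.exp (-(1 / σ ^ 2) * p (x / ε)) * Real.exp (-(1 / σ ^ 2) * V x) := by
  rw [← Real.exp_add]
  ring_nf

theorem PotentialAssumptions.tendsto_partitionFunction {V p : ℝ → ℝ} {L σ : ℝ} [Fact (0 < L)]
    (h : PotentialAssumptions V p L) (hσ : 0 < σ) {ε : ℕ → ℝ} (hε_pos : ∀ k, 0 < ε k)
    (hε : Tendsto ε atTop (𝓝 0)) :
    Tendsto (fun k => (partitionFunction (fun x => V x + p (x / ε k)) σ : ℂ)) atTop
      (𝓝 (circleMean L (h.fastWeight σ) * partitionFunction V σ)) := by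
  have hint : Integrable fun x => ((Real.exp (-(1 / σ ^ 2) * V x) : ℝ) : ℂ) :=
    (h.integrable_exp (by positivity)).ofReal
  have := tendsto_integral_periodic_mul hε_pos hε hint (h.fastWeight σ)
  rw [integral_complex_ofReal] at this
  refine this.congr fun k => ?_
  rw [partitionFunction, ← integral_complex_ofReal]
  refine integral_congr_ae (ae_of_all _ fun x => ?_)
  simp only [h.fastWeight_coe, exp_add_eq_mul, Complex.ofReal_mul]

/-- The slow-scale Gibbs weight `e^{-V / σ²}` as an element of `L²(ℝ; ℂ)`. -/
noncomputable def PotentialAssumptions.slowWeight {V p : ℝ → ℝ} {L σ : ℝ}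
    (h : PotentialAssumptions V p L) (hσ : 0 < σ) : Lp ℂ 2 (volume : Measure ℝ) :=
  (h.memLp_exp (a := 1 / σ ^ 2) (by positivity)).ofReal.toLp

theorem PotentialAssumptions.coeFn_slowWeight {V p : ℝ → ℝ} {L σ : ℝ}
    (h : PotentialAssumptions V p L) (hσ : 0 < σ) :
    h.slowWeight hσ =ᵐ[volume] fun x => ((Real.exp (-(1 / σ ^ 2) * V x) : ℝ) : ℂ) :=
  MemLp.coeFn_toLp _

/-- The multiscale density, represented in `L²` as a multiple of the oscillating multiplier applied
to the slow weight. -/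
theorem PotentialAssumptions.coeFn_multiscaleDensity {V p : ℝ → ℝ} {L σ : ℝ} [Fact (0 < L)]
    (h : PotentialAssumptions V p L) (hσ : 0 < σ) (ε : ℝ) :
    ((partitionFunction (fun x => V x + p (x / ε)) σ : ℂ)⁻¹ •
      periodicMul L ε (h.fastWeight σ) (h.slowWeight hσ) : Lp ℂ 2 (volume : Measure ℝ))
      =ᵐ[volume] fun x => (multiscaleDensity V p σ ε x : ℂ) := by
  filter_upwards [Lp.coeFn_smul (partitionFunction (fun x => V x + p (x / ε)) σ : ℂ)⁻¹
    (periodicMul L ε (h.fastWeight σ) (h.slowWeight hσ)),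
    coeFn_periodicMul ε (h.fastWeight σ) (h.slowWeight hσ), h.coeFn_slowWeight hσ] with x h1 h2 h3
  rw [h1, Pi.smul_apply, h2, h3, h.fastWeight_coe, multiscaleDensity, gibbsDensity, exp_add_eq_mul]
  push_cast
  simp

theorem PotentialAssumptions.coeFn_homogenizedDensity {V p : ℝ → ℝ} {L σ : ℝ}
    (h : PotentialAssumptions V p L) (hσ : 0 < σ) :
    ((partitionFunction V σ : ℂ)⁻¹ • h.slowWeight hσ : Lp ℂ 2 (volume : Measure ℝ))
      =ᵐ[volume] fun x => (homogenizedDensity V σ x : ℂ) := by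
  filter_upwards [Lp.coeFn_smul (partitionFunction V σ : ℂ)⁻¹ (h.slowWeight hσ),
    h.coeFn_slowWeight hσ] with x h1 h2
  rw [h1, Pi.smul_apply, h2, homogenizedDensity, gibbsDensity]
  push_cast
  simp

/-! ### Convergence of the truncated expansions -/

theorem coeFn_partialSum_hermiteLp {f : ℝ → ℝ} {F : Lp ℂ 2 (volume : Measure ℝ)}
    (hF : F =ᵐ[volume] fun x => (f x : ℂ)) (N : ℕ) :
    partialSum hermiteLp N F =ᵐ[volume] fun x => (hermiteProjection f N x : ℂ) := by
  have hcoeff (n : ℕ) : inner ℂ (hermiteLp n) F = (hermiteCoeff f n : ℂ) := by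
    rw [inner_hermiteLp, hermiteCoeff, ← integral_complex_ofReal]
    refine integral_congr_ae ?_
    filter_upwards [hF] with x hx
    simp [hx]
  rw [partialSum_apply]
  induction N with
  | zero =>
    rw [Finset.sum_range_zero]
    filter_upwards [Lp.coeFn_zero ℂ 2 (volume : Measure ℝ)] with x hx
    rw [hx]
    simp [hermiteProjection]
  | succ N ih =>
    rw [Finset.sum_range_succ]
    filter_upwards [ih, Lp.coeFn_add (∑ n ∈ Finset.range N, inner ℂ (hermiteLp n) F • hermiteLp n)
      (inner ℂ (hermiteLp N) F • hermiteLp N), Lp.coeFn_smul (inner ℂ (hermiteLp N) F)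
      (hermiteLp N), coeFn_hermiteLp N] with x h1 h2 h3 h4
    rw [h2, Pi.add_apply, h1, h3, Pi.smul_apply, h4, hcoeff, hermiteProjection, hermiteProjection,
      Finset.sum_range_succ]
    push_cast
    rfl

theorem three_lt_of_gammaThreshold_lt {σ γ : ℝ} (hγ : gammaThreshold σ < γ) : 3 < γ := by
  rw [gammaThreshold] at hγ
  split_ifs at hγ with h
  · linarith [Real.log_nonneg (show (1 : ℝ) ≤ 8 by norm_num)]
  · have h1 := le_max_left (16 * Real.exp (3 / 2)) ((σ ^ 2 + 1) / σ ^ 2 / 4 *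
      (Real.log |2 / ((σ ^ 2 + 1) / σ ^ 2) - 1| + 2 * Real.log 4))
    have h2 := Real.add_one_le_exp (3 / 2 : ℝ)
    have h3 := sq_nonneg ((σ ^ 2 + 1) / σ ^ 2)
    simp only at hγ
    linarith

end MultiscaleLangevin

theorem mainTheorem3 (V p : ℝ → ℝ) (L σ γ : ℝ) (hL : 0 < L) (hσ : 0 < σ)
    (hVp : MultiscaleLangevin.PotentialAssumptions V p L)
    (hγ : MultiscaleLangevin.gammaThreshold σ < γ)
    (ε : ℕ → ℝ) (hε_pos : ∀ k, 0 < ε k) (hε : Tendsto ε atTop (𝓝 0))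
    (N : ℕ → ℕ) (hN : Tendsto N atTop atTop)
    (hN_two : ∀ k, 2 ≤ N k)
    (hN_le : ∀ k, N k ≤ ⌊Real.pi ^ 2 / (γ * L ^ 2 * ε k ^ 2)⌋₊) :
    Tendsto
      (fun k => eLpNorm
        (fun x => MultiscaleLangevin.hermiteProjection
            (MultiscaleLangevin.multiscaleDensity V p σ (ε k)) (N k) x
          - MultiscaleLangevin.homogenizedDensity V σ x) 2 volume)
      atTop (𝓝 0) := by
  open MultiscaleLangevin in
  have : Fact (0 < L) := ⟨hL⟩
  have hγ3 := three_lt_of_gammaThreshold_lt hγ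
  have hN_le' (k : ℕ) : (N k : ℝ) ≤ Real.pi ^ 2 / (γ * L ^ 2 * ε k ^ 2) :=
    (Nat.le_floor_iff (by positivity)).mp (hN_le k)
  have hZ : (partitionFunction V σ : ℂ) ≠ 0 :=
    Complex.ofReal_ne_zero.mpr (hVp.partitionFunction_pos hσ).ne'
  have hm := hVp.circleMean_fastWeight_ne_zero σ
  have hlim := ((hVp.tendsto_partitionFunction hσ hε_pos hε).inv₀ (mul_ne_zero hm hZ)).smul
    (tendsto_partialSum_periodicMul hγ3 hε_pos hε hN hN_le' (hVp.fastWeight σ)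
      (hVp.slowWeight hσ))
  rw [smul_smul, mul_inv_rev, inv_mul_cancel_right₀ hm] at hlim
  have hnorm := (hlim.sub_const ((partitionFunction V σ : ℂ)⁻¹ • hVp.slowWeight hσ)).enorm
  rw [sub_self, enorm_zero] at hnorm
  refine hnorm.congr fun k => ?_
  rw [← map_smul, Lp.enorm_def]
  refine eLpNorm_congr_norm_ae ?_
  filter_upwards [Lp.coeFn_sub (partialSum hermiteLp (N k)
      ((partitionFunction (fun x => V x + p (x / ε k)) σ : ℂ)⁻¹ •
        periodicMul L (ε k) (hVp.fastWeight σ) (hVp.slowWeight hσ)))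
      ((partitionFunction V σ : ℂ)⁻¹ • hVp.slowWeight hσ),
    coeFn_partialSum_hermiteLp (hVp.coeFn_multiscaleDensity hσ (ε k)) (N k),
    hVp.coeFn_homogenizedDensity hσ] with x h1 h2 h3
  rw [h1, Pi.sub_apply, h2, h3, ← Complex.ofReal_sub, Complex.norm_real]
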